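/- Let $m \ge 2$ and $k \ge 2$ be integers. Let $\mathfrak f_m$ be the free real Lie algebra on $m$ generators, with lower central series $C^0(\mathfrak f_m)=\mathfrak f_m$, $C^{r+1}(\mathfrak f_m)=[\mathfrak f_m, C^{r}(\mathfrak f_m)]$, and let $\mathfrak n_{m,k}=\mathfrak f_m/C^{k}(\mathfrak f_m)$ be the free $k$-step nilpotent Lie algebra on $m$ generators (a finite-dimensional real Lie algebra). A symplectic structure on a finite-dimensional real Lie algebra $\mathfrak g$ is a non-degenerate alternating bilinear form $\omega:\mathfrak g\times\mathfrak g\to\mathbb R$ which is closed, i.e. $\omega([x,y],z)+\omega([y,z],x)+\omega([z,x],y)=0$ for all $x,y,z\in\mathfrak g$. Then: 1. If $\dim \mathfrak n_{m,k}$ is even, then $\mathfrak n_{m,k}$ admits a symplectic structure if and only if $(m,k)=(3,2)$. 2. If $\dim \mathfrak n_{m,k}$ is odd, then the one-dimensional central extension $\mathbb R\oplus\mathfrak n_{m,k}$ (the direct sum of Lie algebras with the abelian Lie algebra $\mathbb R$) admits a symplectic structure if and only if $(m,k)=(2,2)$. -/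

import Mathlib

/- The commutator bracket of an associative ring. It is used only to regard the commutative ring
`ℝ` as the one-dimensional abelian Lie algebra. -/
attribute [local instance 100] LieRing.ofAssociativeRing

/-- The free `k`-step nilpotent real Lie algebra on `m` generators: the quotient of the free Lie
algebra `f` on `m` generators by the term `C^k(f)` of its lower central series, where `C^0(f) = f`
and `C^(r+1)(f) = [f, C^r(f)]`. Thus exactly the brackets of more than `k` elements vanish. -/
abbrev FreeNilpotentLieAlgebra (m k : ℕ) : Type :=
  FreeLieAlgebra ℝ (Fin m) ⧸
    (LieModule.lowerCentralSeries ℝ (FreeLieAlgebra ℝ (Fin m)) (FreeLieAlgebra ℝ (Fin m)) k :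
      LieIdeal ℝ (FreeLieAlgebra ℝ (Fin m)))

/-- A bilinear form `ω` on a real Lie algebra is a symplectic structure if it is a `2`-form
(alternating), closed for the Chevalley–Eilenberg differential
`(dω)(x, y, z) = -(ω([x,y],z) + ω([y,z],x) + ω([z,x],y))`, and non-degenerate. -/
structure IsSymplecticStructure {L : Type*} [LieRing L] [LieAlgebra ℝ L]
    (ω : LinearMap.BilinForm ℝ L) : Prop where
  alternating : ω.IsAlt
  closed : ∀ x y z : L, ω ⁅x, y⁆ z + ω ⁅y, z⁆ x + ω ⁅z, x⁆ y = 0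
  nondegenerate : ω.Nondegenerate

/-- A real Lie algebra is symplectic if it admits a symplectic structure. -/
def IsSymplecticLieAlgebra (L : Type*) [LieRing L] [LieAlgebra ℝ L] : Prop :=
  ∃ ω : LinearMap.BilinForm ℝ L, IsSymplecticStructure ω

/-! For a symplectic form `ω`, closedness makes the centre `ω`-orthogonal to the derived algebra, so
non-degeneracy embeds the centre into the dual of the abelianization, of dimension at most `m`. For
`ℝ × n_{m,k}` the same argument with the additional central direction `ℝ` makes the inequality
strict. On the other hand the last nonzero layer of `n_{m,k}` is central and contains the basic
commutators `⁅a₁, … ⁅i, j⁆ … ⁆` with `i < j` and `i ≤ aᵣ` of weight `k`. They are independent, as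
they are separated by the coefficients of their Fox derivatives in the symmetric algebra of the
abelianization. Counting them leaves only `(2, 2)`, `(2, 3)` and `(3, 2)` in the first case, where
the dimensions `3` and `5` exclude the first two, and `(2, 2)` in the second. Conversely,
evaluating a functional `f` on `n_{m,k+1}` at the bracket of lifts gives a well-defined closed form
on `n_{m,k}`. A suitable `f` makes it non-degenerate for `(3, 2)`; for `(2, 2)` one adds `dt ∧ c`,
where `t` is the coordinate on `ℝ` and `c` vanishes on brackets. -/

section IteratedLie

variable {L X : Type*} [LieRing L]

/-- The right-normed bracket `⁅g a₁, ⁅g a₂, … ⁅g i, g j⁆ … ⁆⁆` attached to a list `[a₁, a₂, …]`. -/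
def iteratedLie (g : X → L) (l : List X) (i j : X) : L :=
  l.foldr (fun a z => ⁅g a, z⁆) ⁅g i, g j⁆

theorem iteratedLie_nil (g : X → L) (i j : X) : iteratedLie g [] i j = ⁅g i, g j⁆ :=
  rfl

theorem iteratedLie_cons (g : X → L) (a : X) (l : List X) (i j : X) :
    iteratedLie g (a :: l) i j = ⁅g a, iteratedLie g l i j⁆ :=
  rfl

theorem iteratedLie_self (g : X → L) (l : List X) (i : X) : iteratedLie g l i i = 0 := by
  induction l with
  | nil => exact lie_self _
  | cons a l ih => rw [iteratedLie_cons, ih, lie_zero]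

theorem iteratedLie_swap (g : X → L) (l : List X) (i j : X) :
    iteratedLie g l i j = -iteratedLie g l j i := by
  induction l with
  | nil => exact (lie_skew _ _).symm
  | cons a l ih => rw [iteratedLie_cons, ih, lie_neg, iteratedLie_cons]

theorem map_iteratedLie {R L' : Type*} [CommRing R] [LieAlgebra R L] [LieRing L'] [LieAlgebra R L']
    (φ : L →ₗ⁅R⁆ L') (g : X → L) (l : List X) (i j : X) :
    φ (iteratedLie g l i j) = iteratedLie (φ ∘ g) l i j := by
  induction l with
  | nil => exact φ.map_lie _ _
  | cons a l ih => rw [iteratedLie_cons, φ.map_lie, ih, iteratedLie_cons, Function.comp_apply]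

theorem iteratedLie_mem_lowerCentralSeries (R : Type*) [CommRing R] [LieAlgebra R L] (g : X → L)
    (l : List X) (i j : X) :
    iteratedLie g l i j ∈ LieModule.lowerCentralSeries R L L (l.length + 1) := by
  induction l with
  | nil => exact LieSubmodule.lie_mem_lie (LieSubmodule.mem_top _) (LieSubmodule.mem_top _)
  | cons a l ih =>
    rw [iteratedLie_cons, List.length_cons, LieModule.lowerCentralSeries_succ]
    exact LieSubmodule.lie_mem_lie (LieSubmodule.mem_top _) ih

end IteratedLie

section LieGeneration

variable {R L : Type*} [CommRing R] [LieRing L] [LieAlgebra R L]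

theorem submodule_eq_top_of_forall_lie_mem {s : Set L} (hs : LieSubalgebra.lieSpan R L s = ⊤)
    {K : Submodule R L} (hsK : s ⊆ K) (hK : ∀ x ∈ s, ∀ y ∈ K, ⁅x, y⁆ ∈ K) : K = ⊤ := by
  have hstab (x : L) : ∀ y ∈ K, ⁅x, y⁆ ∈ K := by
    have hx : x ∈ LieSubalgebra.lieSpan R L s := hs ▸ LieSubalgebra.mem_top x
    induction hx using LieSubalgebra.lieSpan_induction with
    | mem x hx => exact hK x hx
    | zero => simp
    | add x z _ _ hx hz => exact fun y hy => add_lie x z y ▸ K.add_mem (hx y hy) (hz y hy)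
    | smul a x _ hx => exact fun y hy => smul_lie a x y ▸ K.smul_mem a (hx y hy)
    | lie x z _ _ hx hz =>
      exact fun y hy => lie_lie x z y ▸ K.sub_mem (hx _ (hz y hy)) (hz _ (hx y hy))
  let K' : LieSubalgebra R L := { K with lie_mem' := fun {x y} _ hy => hstab x y hy }
  have hle : LieSubalgebra.lieSpan R L s ≤ K' := LieSubalgebra.lieSpan_le.mpr hsK
  exact eq_top_iff.mpr fun x _ => hle (hs ▸ LieSubalgebra.mem_top x)

theorem span_range_union_iteratedLie_eq_top {X : Type*} {g : X → L}
    (hg : LieSubalgebra.lieSpan R L (Set.range g) = ⊤) :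
    Submodule.span R (Set.range g ∪ {x : L | ∃ l i j, iteratedLie g l i j = x}) = ⊤ := by
  refine submodule_eq_top_of_forall_lie_mem hg
    (Set.subset_union_left.trans Submodule.subset_span) ?_
  rintro _ ⟨a, rfl⟩ y hy
  induction hy using Submodule.span_induction with
  | mem y hy =>
    refine Submodule.subset_span (Or.inr ?_)
    obtain ⟨b, rfl⟩ | ⟨l, i, j, rfl⟩ := hy
    · exact ⟨[], a, b, iteratedLie_nil g a b⟩
    · exact ⟨a :: l, i, j, iteratedLie_cons g a l i j⟩
  | zero => simp
  | add y z _ _ hy hz => exact lie_add (g a) y z ▸ add_mem hy hz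
  | smul c y _ hy => exact lie_smul c (g a) y ▸ Submodule.smul_mem _ c hy

theorem lie_mem_lowerCentralSeries_succ {k : ℕ} (x : L) {y : L}
    (hy : y ∈ LieModule.lowerCentralSeries R L L k) :
    ⁅x, y⁆ ∈ LieModule.lowerCentralSeries R L L (k + 1) := by
  rw [LieModule.lowerCentralSeries_succ]
  exact LieSubmodule.lie_mem_lie (LieSubmodule.mem_top x) hy

theorem toSubmodule_lie_le {I J : LieIdeal R L} {K : Submodule R L}
    (h : ∀ x ∈ I, ∀ y ∈ J, ⁅x, y⁆ ∈ K) : ⁅I, J⁆.toSubmodule ≤ K := by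
  rw [LieSubmodule.lieIdeal_oper_eq_linear_span', Submodule.span_le]
  rintro _ ⟨x, hx, y, hy, rfl⟩
  exact h x hx y hy

theorem lie_mem_derivedIdeal (x y : L) : ⁅x, y⁆ ∈ ⁅(⊤ : LieIdeal R L), (⊤ : LieIdeal R L)⁆ :=
  LieSubmodule.lie_mem_lie (LieSubmodule.mem_top x) (LieSubmodule.mem_top y)

theorem derivedIdeal_sup_span_eq_top {s : Set L} (hs : LieSubalgebra.lieSpan R L s = ⊤) :
    ⁅(⊤ : LieIdeal R L), (⊤ : LieIdeal R L)⁆.toSubmodule ⊔ Submodule.span R s = ⊤ :=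
  submodule_eq_top_of_forall_lie_mem hs
    (fun _ hx => Submodule.mem_sup_right (Submodule.subset_span hx))
    fun x _ y _ => Submodule.mem_sup_left (lie_mem_derivedIdeal x y)

end LieGeneration

theorem lieSpan_range_freeLieAlgebra_of (R : Type*) [CommRing R] (X : Type*) :
    LieSubalgebra.lieSpan R (FreeLieAlgebra R X) (Set.range (FreeLieAlgebra.of R)) = ⊤ := by
  set S := LieSubalgebra.lieSpan R (FreeLieAlgebra R X) (Set.range (FreeLieAlgebra.of R))
  let φ : FreeLieAlgebra R X →ₗ⁅R⁆ S :=
    FreeLieAlgebra.lift R fun i => ⟨_, LieSubalgebra.subset_lieSpan (Set.mem_range_self i)⟩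
  have hφ : S.incl.comp φ = LieHom.id := FreeLieAlgebra.hom_ext fun i => by simp [φ]
  refine eq_top_iff.mpr fun x _ => ?_
  rw [← show (φ x : FreeLieAlgebra R X) = x from congr($hφ x)]
  exact (φ x).2

@[elab_as_elim]
theorem freeLieAlgebra_induction {R X : Type*} [CommRing R] {p : FreeLieAlgebra R X → Prop}
    (of : ∀ i, p (FreeLieAlgebra.of R i)) (zero : p 0) (add : ∀ x y, p x → p y → p (x + y))
    (smul : ∀ (a : R) x, p x → p (a • x)) (lie : ∀ x y, p x → p y → p ⁅x, y⁆)
    (x : FreeLieAlgebra R X) : p x := by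
  have hx : x ∈ LieSubalgebra.lieSpan R (FreeLieAlgebra R X) (Set.range (FreeLieAlgebra.of R)) :=
    lieSpan_range_freeLieAlgebra_of R X ▸ LieSubalgebra.mem_top x
  induction hx using LieSubalgebra.lieSpan_induction with
  | mem x hx => exact hx.elim fun i hi => hi ▸ of i
  | zero => exact zero
  | add x y _ _ hx hy => exact add x y hx hy
  | smul a x _ hx => exact smul a x hx
  | lie x y _ _ hx hy => exact lie x y hx hy

section FoxDerivative

open MvPolynomial

variable {R X : Type*} [CommRing R]

/-- The image of an element of the free Lie algebra in the symmetric algebra of its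
abelianization, which is the polynomial ring on the generators. -/
noncomputable def abelianPart : FreeLieAlgebra R X →ₗ⁅R⁆ MvPolynomial X R :=
  FreeLieAlgebra.lift R MvPolynomial.X

theorem abelianPart_of (i : X) :
    abelianPart (FreeLieAlgebra.of R i) = (MvPolynomial.X i : MvPolynomial X R) := by
  simp [abelianPart]

theorem abelianPart_lie (x y : FreeLieAlgebra R X) : abelianPart ⁅x, y⁆ = 0 := by
  rw [LieHom.map_lie, LieRing.of_associative_ring_bracket, mul_comm, sub_self]

theorem abelianPart_mem_idealOfVars (x : FreeLieAlgebra R X) :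
    abelianPart x ∈ idealOfVars X R := by
  induction x using freeLieAlgebra_induction with
  | of i => exact abelianPart_of (R := R) i ▸ Ideal.subset_span (Set.mem_range_self i)
  | zero => simp
  | add x y hx hy => exact map_add abelianPart x y ▸ add_mem hx hy
  | smul a x hx =>
    rw [map_smul]
    exact Submodule.smul_of_tower_mem _ a hx
  | lie x y _ _ => exact abelianPart_lie x y ▸ zero_mem _

theorem abelianPart_iteratedLie (g : X → FreeLieAlgebra R X) (l : List X) (i j : X) :
    abelianPart (iteratedLie g l i j) = 0 := by
  cases l <;> exact abelianPart_lie _ _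

theorem abelianPart_mem_pow_idealOfVars {r : ℕ} {x : FreeLieAlgebra R X}
    (hx : x ∈ LieModule.lowerCentralSeries R (FreeLieAlgebra R X) (FreeLieAlgebra R X) r) :
    abelianPart x ∈ idealOfVars X R ^ (r + 1) := by
  cases r with
  | zero => exact (pow_one (idealOfVars X R)).symm ▸ abelianPart_mem_idealOfVars x
  | succ r =>
    rw [LieModule.lowerCentralSeries_succ] at hx
    have h : abelianPart x = 0 := toSubmodule_lie_le (K := (abelianPart (R := R)).toLinearMap.ker)
      (fun y _ z _ => abelianPart_lie y z) hx
    exact h ▸ zero_mem _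

variable [DecidableEq X]

/-- The Magnus representation of the free Lie algebra by upper triangular matrices over the
polynomial ring, restricted to its `j`-th off-diagonal coordinate. -/
noncomputable def magnusRep (j : X) :
    FreeLieAlgebra R X →ₗ⁅R⁆ Matrix (Fin 2) (Fin 2) (MvPolynomial X R) :=
  FreeLieAlgebra.lift R fun i => !![.X i, if i = j then 1 else 0; 0, 0]

/-- The `j`-th Fox derivative on the free Lie algebra, with values abelianized to the polynomial
ring: the crossed homomorphism sending the `j`-th generator to `1` and the others to `0`. -/
noncomputable def foxDerivative (j : X) : FreeLieAlgebra R X →ₗ[R] MvPolynomial X R :=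
  Matrix.entryLinearMap R (MvPolynomial X R) (0 : Fin 2) (1 : Fin 2) ∘ₗ
    (magnusRep (R := R) j).toLinearMap

theorem foxDerivative_of (i j : X) :
    foxDerivative j (FreeLieAlgebra.of R i) = (if i = j then 1 else 0 : MvPolynomial X R) := by
  simp [foxDerivative, magnusRep]

theorem magnusRep_apply (j : X) (x : FreeLieAlgebra R X) :
    magnusRep j x = !![abelianPart x, foxDerivative j x; 0, 0] := by
  suffices h : ∃ d, magnusRep j x = !![abelianPart x, d; 0, 0] by
    obtain ⟨d, hd⟩ := h
    simp [foxDerivative, hd]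
  induction x using freeLieAlgebra_induction with
  | of i => exact ⟨if i = j then 1 else 0, by simp [magnusRep, abelianPart_of]⟩
  | zero => exact ⟨0, by ext a b; fin_cases a <;> fin_cases b <;> simp⟩
  | add x y hx hy =>
    obtain ⟨⟨d, hd⟩, e, he⟩ := hx, hy
    exact ⟨d + e, by simp [hd, he]⟩
  | smul a x hx =>
    obtain ⟨d, hd⟩ := hx
    exact ⟨a • d, by simp [hd, Matrix.smul_of]⟩
  | lie x y hx hy =>
    obtain ⟨⟨d, hd⟩, e, he⟩ := hx, hy
    refine ⟨abelianPart x * e - abelianPart y * d, ?_⟩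
    rw [LieHom.map_lie, hd, he, abelianPart_lie]
    ext a b : 2
    fin_cases a <;> fin_cases b <;>
      simp [LieRing.of_associative_ring_bracket, mul_comm]

theorem foxDerivative_lie (j : X) (x y : FreeLieAlgebra R X) :
    foxDerivative j ⁅x, y⁆ =
      abelianPart x * foxDerivative j y - abelianPart y * foxDerivative j x := by
  have h := congr($((magnusRep j).map_lie x y) 0 1)
  rw [LieRing.of_associative_ring_bracket] at h
  simpa [magnusRep_apply, -LieHom.map_lie] using h

theorem foxDerivative_mem_pow_idealOfVars (j : X) {r : ℕ} {x : FreeLieAlgebra R X}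
    (hx : x ∈ LieModule.lowerCentralSeries R (FreeLieAlgebra R X) (FreeLieAlgebra R X) r) :
    foxDerivative j x ∈ idealOfVars X R ^ r := by
  induction r generalizing x with
  | zero => simp
  | succ r ih =>
    rw [LieModule.lowerCentralSeries_succ] at hx
    refine toSubmodule_lie_le
      (K := ((idealOfVars X R ^ (r + 1)).restrictScalars R).comap (foxDerivative j)) ?_ hx
    intro y _ z hz
    rw [Submodule.mem_comap, Submodule.restrictScalars_mem, foxDerivative_lie]
    refine sub_mem ?_ (Ideal.mul_mem_right _ _ (abelianPart_mem_pow_idealOfVars hz))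
    rw [pow_succ']
    exact Ideal.mul_mem_mul (abelianPart_mem_idealOfVars y) (ih hz)

/-- The functional on the free Lie algebra that reads off the coefficient of the monomial
`∏ i ∈ μ, X i` in the `j`-th Fox derivative. -/
noncomputable def foxCoeff (μ : Multiset X) (j : X) : FreeLieAlgebra R X →ₗ[R] R :=
  lcoeff R (Multiset.toFinsupp μ) ∘ₗ foxDerivative j

theorem foxCoeff_eq_zero_of_mem_lowerCentralSeries {μ : Multiset X} {r : ℕ}
    (hμ : μ.card < r) (j : X) {x : FreeLieAlgebra R X}
    (hx : x ∈ LieModule.lowerCentralSeries R (FreeLieAlgebra R X) (FreeLieAlgebra R X) r) :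
    foxCoeff μ j x = 0 := by
  refine (mem_pow_idealOfVars_iff' r _).mp (foxDerivative_mem_pow_idealOfVars j hx) _ ?_
  rwa [← Multiset.toFinsupp_sum_eq] at hμ

theorem lcoeff_toFinsupp_monomial_toFinsupp (μ s : Multiset X) :
    lcoeff R (Multiset.toFinsupp μ) (monomial (Multiset.toFinsupp s) 1) =
      if s = μ then 1 else 0 := by
  simp only [lcoeff, LinearMap.coe_mk, AddHom.coe_mk, coeff_monomial,
    EmbeddingLike.apply_eq_iff_eq]

theorem foxCoeff_of (μ : Multiset X) (i j : X) :
    foxCoeff μ j (FreeLieAlgebra.of R i) = if i = j ∧ 0 = μ then 1 else 0 := by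
  rw [foxCoeff, LinearMap.comp_apply, foxDerivative_of, one_def, ← map_zero Multiset.toFinsupp,
    apply_ite (lcoeff R _), lcoeff_toFinsupp_monomial_toFinsupp, map_zero, ite_and]

theorem X_mul_monomial_toFinsupp (a : X) (s : Multiset X) :
    MvPolynomial.X a * monomial (Multiset.toFinsupp s) (1 : R) =
      monomial (Multiset.toFinsupp (a ::ₘ s)) 1 := by
  rw [MvPolynomial.X, monomial_mul, one_mul, ← Multiset.singleton_add, map_add,
    Multiset.toFinsupp_singleton]

theorem foxDerivative_iteratedLie (l : List X) (i j d : X) :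
    foxDerivative d (iteratedLie (FreeLieAlgebra.of R) l i j) =
      (if j = d then monomial (Multiset.toFinsupp (i ::ₘ (l : Multiset X))) 1 else 0) -
        if i = d then monomial (Multiset.toFinsupp (j ::ₘ (l : Multiset X))) 1 else 0 := by
  induction l with
  | nil =>
    simp [iteratedLie_nil, foxDerivative_lie, abelianPart_of, foxDerivative_of, MvPolynomial.X]
  | cons a l ih =>
    rw [iteratedLie_cons, foxDerivative_lie, abelianPart_iteratedLie, zero_mul, sub_zero,
      abelianPart_of, ih, mul_sub, mul_ite, mul_ite, mul_zero, X_mul_monomial_toFinsupp,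
      X_mul_monomial_toFinsupp, Multiset.cons_swap a, Multiset.cons_swap a, Multiset.cons_coe]

theorem foxCoeff_iteratedLie (μ : Multiset X) (l : List X) (i j d : X) :
    foxCoeff μ d (iteratedLie (FreeLieAlgebra.of R) l i j) =
      (if j = d ∧ i ::ₘ (l : Multiset X) = μ then 1 else 0) -
        if i = d ∧ j ::ₘ (l : Multiset X) = μ then 1 else 0 := by
  simp only [foxCoeff, LinearMap.comp_apply, foxDerivative_iteratedLie, map_sub, map_zero, ite_and,
    apply_ite (lcoeff R (Multiset.toFinsupp μ)), lcoeff_toFinsupp_monomial_toFinsupp]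

end FoxDerivative

section BasicCommutator

/-- The indices of the basic commutators `⁅a₁, ⁅a₂, … ⁅i, j⁆ … ⁆⁆` of weight `n + 2` in the free
metabelian Lie algebra, namely `i < j` together with a multiset `{a₁, …, aₙ}` bounded below
by `i`. -/
abbrev BasicCommutator (X : Type*) [LinearOrder X] (n : ℕ) : Type _ :=
  {p : X × X × Sym X n // p.1 < p.2.1 ∧ ∀ a ∈ (p.2.2 : Multiset X), p.1 ≤ a}

namespace BasicCommutator

variable {X : Type*} [LinearOrder X] {n : ℕ}

/-- The Lie element indexed by a basic commutator, formed from a family `g` of elements. The order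
in which the multiset is listed is chosen arbitrarily. -/
noncomputable def eval {L : Type*} [LieRing L] (g : X → L) (c : BasicCommutator X n) : L :=
  iteratedLie g (c.1.2.2 : Multiset X).toList c.1.1 c.1.2.1

theorem eval_mem_lowerCentralSeries (R : Type*) {L : Type*} [CommRing R] [LieRing L]
    [LieAlgebra R L] (g : X → L) (c : BasicCommutator X n) :
    c.eval g ∈ LieModule.lowerCentralSeries R L L (n + 1) := by
  have h := iteratedLie_mem_lowerCentralSeries R g (c.1.2.2 : Multiset X).toList c.1.1 c.1.2.1
  rwa [Multiset.length_toList, Sym.card_coe] at h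

theorem eq_of_cons_eq_cons {i i' : X} {s s' : Multiset X} (h : i ::ₘ s = i' ::ₘ s')
    (hs : ∀ a ∈ s, i ≤ a) (hs' : ∀ a ∈ s', i' ≤ a) : i = i' :=
  le_antisymm
    (Multiset.forall_mem_cons.mpr ⟨le_rfl, hs⟩ i' (h ▸ Multiset.mem_cons_self i' s'))
    (Multiset.forall_mem_cons.mpr ⟨le_rfl, hs'⟩ i (h ▸ Multiset.mem_cons_self i s))

theorem foxCoeff_eval {R : Type*} [CommRing R] (c d : BasicCommutator X n) :
    foxCoeff (c.1.1 ::ₘ c.1.2.2) c.1.2.1 (d.eval (FreeLieAlgebra.of R)) =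
      if c = d then 1 else 0 := by
  obtain ⟨⟨i, j, s⟩, hij, his⟩ := c
  obtain ⟨⟨i', j', s'⟩, hij', his'⟩ := d
  have hleading : (j' = j ∧ i' ::ₘ (s' : Multiset X) = i ::ₘ s) ↔ i = i' ∧ j = j' ∧ s = s' := by
    refine ⟨fun ⟨hj, hs⟩ => ?_, by rintro ⟨rfl, rfl, rfl⟩; exact ⟨rfl, rfl⟩⟩
    obtain rfl := eq_of_cons_eq_cons hs his' his
    exact ⟨rfl, hj.symm, (Sym.coe_injective ((Multiset.cons_inj_right _).mp hs)).symm⟩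
  have htrailing : ¬ (i' = j ∧ j' ::ₘ (s' : Multiset X) = i ::ₘ s) := by
    rintro ⟨rfl, hs⟩
    have hi : i ∈ j' ::ₘ (s' : Multiset X) := hs ▸ Multiset.mem_cons_self i s
    rcases Multiset.mem_cons.mp hi with rfl | hi
    · exact lt_asymm hij hij'
    · exact (his' i hi).not_gt hij
  simp only [eval, foxCoeff_iteratedLie, Multiset.coe_toList, hleading, htrailing, if_false,
    sub_zero, Subtype.mk.injEq, Prod.mk.injEq]

theorem choose_two_le_card (m n : ℕ) : m.choose 2 ≤ Fintype.card (BasicCommutator (Fin m) n) := by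
  let f (p : Σ j : Fin m, Fin j) : BasicCommutator (Fin m) n :=
    ⟨(p.2.castLE p.1.2.le, p.1, Sym.replicate n p.1), p.2.2, fun a ha =>
      (Multiset.eq_of_mem_replicate ha).symm ▸ p.2.2.le⟩
  have hf : Function.Injective f := by
    rintro ⟨j, i⟩ ⟨j', i'⟩ h
    obtain rfl : j = j' := congr(($h).1.2.1)
    obtain rfl : i = i' := Fin.castLE_injective j.2.le congr(($h).1.1)
    rfl
  calc m.choose 2 = ∑ j : Fin m, (j : ℕ) := by
        rw [Fin.sum_univ_eq_sum_range fun j => j, Finset.sum_range_id, Nat.choose_two_right]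
    _ = Fintype.card (Σ j : Fin m, Fin j) := by simp
    _ ≤ _ := Fintype.card_le_of_injective f hf

theorem mul_multichoose_le_card (m n : ℕ) :
    m * Nat.multichoose (m + 1) n ≤ Fintype.card (BasicCommutator (Fin (m + 1)) n) := by
  let f (p : Fin m × Sym (Fin (m + 1)) n) : BasicCommutator (Fin (m + 1)) n :=
    ⟨(0, p.1.succ, p.2), p.1.succ_pos, fun a _ => Fin.zero_le a⟩
  have hf : Function.Injective f := by
    rintro ⟨j, s⟩ ⟨j', s'⟩ h
    simpa [f] using h
  simpa [Sym.card_sym_eq_multichoose] using Fintype.card_le_of_injective f hf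

theorem mul_succ_le_card {m : ℕ} (hm : 1 ≤ m) (n : ℕ) :
    m * (n + 1) ≤ Fintype.card (BasicCommutator (Fin (m + 1)) n) := by
  refine (Nat.mul_le_mul_left m ?_).trans (mul_multichoose_le_card m n)
  rw [← Nat.multichoose_two, Nat.multichoose_eq, Nat.multichoose_eq]
  exact Nat.choose_mono n (by omega)

theorem le_card {m n : ℕ} (hm : 2 ≤ m) (h : m = 2 → 1 ≤ n) :
    m ≤ Fintype.card (BasicCommutator (Fin m) n) := by
  obtain rfl | hm : m = 2 ∨ 3 ≤ m := by omega
  · exact le_trans (by omega) (mul_succ_le_card le_rfl n)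
  · refine le_trans ?_ (choose_two_le_card m n)
    obtain ⟨m, rfl⟩ := Nat.exists_eq_add_of_le' hm
    rw [Nat.choose_two_right, Nat.le_div_iff_mul_le two_pos]
    exact Nat.mul_le_mul_left (m + 3) (by omega)

theorem lt_card {m n : ℕ} (hm : 2 ≤ m) (h₂ : m = 2 → 2 ≤ n) (h₃ : m = 3 → 1 ≤ n) :
    m < Fintype.card (BasicCommutator (Fin m) n) := by
  obtain rfl | hm : m = 2 ∨ 3 ≤ m := by omega
  · exact lt_of_lt_of_le (by omega) (mul_succ_le_card le_rfl n)
  obtain rfl | hm : m = 3 ∨ 4 ≤ m := by omega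
  · exact lt_of_lt_of_le (by omega) (mul_succ_le_card one_le_two n)
  · refine lt_of_lt_of_le ?_ (choose_two_le_card m n)
    obtain ⟨m, rfl⟩ := Nat.exists_eq_add_of_le' hm
    rw [Nat.choose_two_right, ← Nat.succ_le_iff, Nat.le_div_iff_mul_le two_pos,
      Nat.add_sub_assoc (by omega)]
    nlinarith

end BasicCommutator
end BasicCommutator

section NondegenerateForm

theorem submodule_prod_eq_top {R M : Type*} [Semiring R] [AddCommMonoid M] [Module R M]
    {K : Submodule R (R × M)} (hK : (1, 0) ∈ K) (hM : K.comap (LinearMap.inr R R M) = ⊤) :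
    K = ⊤ := by
  refine eq_top_iff.mpr fun ⟨t, x⟩ _ => ?_
  have hx : (0, x) ∈ K := show x ∈ K.comap (LinearMap.inr R R M) from hM ▸ Submodule.mem_top
  simpa using add_mem (K.smul_mem t hK) hx

theorem card_le_card_of_sup_span_eq_top {R V ι κ : Type*} [CommRing R] [Nontrivial R]
    [AddCommGroup V] [Module R V] [Fintype ι] [Fintype κ] {ω : LinearMap.BilinForm R V}
    (hω : ω.Nondegenerate) {w : ι → V} (hw : LinearIndependent R w) {W : Submodule R V}
    (hW : ∀ x ∈ W, ∀ i, ω x (w i) = 0) {g : κ → V}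
    (hg : W ⊔ Submodule.span R (Set.range g) = ⊤) : Fintype.card ι ≤ Fintype.card κ := by
  let pairing : V →ₗ[R] κ → R := LinearMap.pi fun c => ω (g c)
  have hdisj : Disjoint (Submodule.span R (Set.range w)) pairing.ker := by
    refine Submodule.disjoint_def.mpr fun v hv hv0 => hω.2 v fun x => ?_
    have hWv : W ≤ (ω.flip v).ker := fun y hy =>
      (Submodule.span_le.mpr (Set.range_subset_iff.mpr (hW y hy)) :
        Submodule.span R (Set.range w) ≤ (ω y).ker) hv
    have hgv : Submodule.span R (Set.range g) ≤ (ω.flip v).ker :=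
      Submodule.span_le.mpr (Set.range_subset_iff.mpr fun c => congrFun hv0 c)
    exact sup_le hWv hgv (hg ▸ Submodule.mem_top)
  simpa using (hw.map hdisj).fintype_card_le_finrank

theorem even_finrank_of_isAlt {K V : Type*} [Field K] [NeZero (2 : K)] [AddCommGroup V]
    [Module K V] {ω : LinearMap.BilinForm K V} (hω : ω.Nondegenerate) (halt : ω.IsAlt) :
    Even (Module.finrank K V) := by
  by_cases hV : Module.Finite K V
  swap
  · simp [Module.finrank_of_not_finite hV]
  let b := Module.finBasis K V
  have hdet : (LinearMap.BilinForm.toMatrix b ω).det ≠ 0 :=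
    (LinearMap.BilinForm.nondegenerate_iff_det_ne_zero b).mp hω
  have htranspose :
      (LinearMap.BilinForm.toMatrix b ω).transpose = -LinearMap.BilinForm.toMatrix b ω := by
    ext i j
    simpa only [Matrix.transpose_apply, Matrix.neg_apply, LinearMap.BilinForm.toMatrix_apply]
      using (LinearMap.IsAlt.neg halt (b i) (b j)).symm
  have hsign := congr(Matrix.det $htranspose)
  rw [Matrix.det_transpose, Matrix.det_neg, Fintype.card_fin] at hsign
  by_contra hodd
  rw [(Nat.not_even_iff_odd.mp hodd).neg_one_pow, neg_one_mul, eq_neg_iff_add_eq_zero, ← two_mul]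
    at hsign
  exact mul_ne_zero two_ne_zero hdet hsign

theorem separatingLeft_of_apply_ne_zero_iff {K V ι : Type*} [Field K] [AddCommGroup V] [Module K V]
    [Finite ι] {ω : LinearMap.BilinForm K V} {v w : ι → V}
    (hv : Submodule.span K (Set.range v) = ⊤) (hvw : ∀ i j, ω (v i) (w j) ≠ 0 ↔ i = j) :
    ω.SeparatingLeft := by
  have := Fintype.ofFinite ι
  intro x hx
  obtain ⟨c, rfl⟩ : ∃ c : ι → K, ∑ i, c i • v i = x :=
    (Submodule.mem_span_range_iff_exists_fun K).mp (hv ▸ Submodule.mem_top)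
  refine Finset.sum_eq_zero fun j _ => ?_
  have hj : ω (∑ i, c i • v i) (w j) = c j * ω (v j) (w j) := by
    rw [map_sum, LinearMap.sum_apply, Finset.sum_eq_single_of_mem j (Finset.mem_univ j)
      fun i _ hij => ?_, map_smul, LinearMap.smul_apply, smul_eq_mul]
    rw [map_smul, LinearMap.smul_apply, not_ne_iff.mp (mt (hvw i j).mp hij), smul_zero]
  have hcj : c j = 0 :=
    (mul_eq_zero.mp (hj.symm.trans (hx (w j)))).resolve_right ((hvw j j).mpr rfl)
  rw [hcj, zero_smul]

theorem finrank_eq_card_of_dual {K V ι : Type*} [Field K] [AddCommGroup V] [Module K V]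
    [Fintype ι] [DecidableEq ι] {v : ι → V} (hv : Submodule.span K (Set.range v) = ⊤)
    {f : ι → Module.Dual K V} (hf : ∀ i j, f i (v j) = if i = j then 1 else 0) :
    Module.finrank K V = Fintype.card ι :=
  have hli : LinearIndependent K v :=
    .of_pairwise_dual_eq_zero_one v f (fun i j hij => (hf i j).trans (if_neg hij))
      fun i => (hf i i).trans (if_pos rfl)
  Module.finrank_eq_card_basis (Module.Basis.mk hli hv.ge)

end NondegenerateForm

namespace IsSymplecticStructure

variable {L : Type*} [LieRing L] [LieAlgebra ℝ L] {ω : LinearMap.BilinForm ℝ L}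

theorem apply_lie_eq_zero_of_mem_center (hω : IsSymplecticStructure ω) {z : L}
    (hz : z ∈ LieAlgebra.center ℝ L) (x y : L) : ω ⁅x, y⁆ z = 0 := by
  have hz' (u : L) : ⁅u, z⁆ = 0 := (LieModule.mem_maxTrivSubmodule ℝ L L z).mp hz u
  have hclosed := hω.closed x y z
  rwa [← lie_skew z x, hz' x, hz' y, neg_zero, map_zero, LinearMap.zero_apply,
    LinearMap.zero_apply, add_zero, add_zero] at hclosed

theorem apply_eq_zero_of_mem_center (hω : IsSymplecticStructure ω) {x z : L}
    (hx : x ∈ ⁅(⊤ : LieIdeal ℝ L), (⊤ : LieIdeal ℝ L)⁆)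
    (hz : z ∈ LieAlgebra.center ℝ L) : ω x z = 0 :=
  toSubmodule_lie_le (K := (ω.flip z).ker)
    (fun x _ y _ => hω.apply_lie_eq_zero_of_mem_center hz x y) hx

end IsSymplecticStructure

theorem mem_center_prod_of_snd_mem {L : Type*} [LieRing L] [LieAlgebra ℝ L] {z : ℝ × L}
    (hz : z.2 ∈ LieAlgebra.center ℝ L) : z ∈ LieAlgebra.center ℝ (ℝ × L) :=
  (LieModule.mem_maxTrivSubmodule ..).mpr fun u => by
    simp [LieAlgebra.Prod.bracket_apply, LieRing.of_associative_ring_bracket, mul_comm,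
      (LieModule.mem_maxTrivSubmodule ℝ L L z.2).mp hz]

namespace IsSymplecticStructure

variable {L : Type*} [LieRing L] [LieAlgebra ℝ L] {ω : LinearMap.BilinForm ℝ (ℝ × L)}

theorem apply_zero_mk_eq_zero_of_mem_center (hω : IsSymplecticStructure ω) {u : L}
    (hu : u ∈ ⁅(⊤ : LieIdeal ℝ L), (⊤ : LieIdeal ℝ L)⁆) {z : ℝ × L}
    (hz : z ∈ LieAlgebra.center ℝ (ℝ × L)) : ω (0, u) z = 0 :=
  toSubmodule_lie_le (K := (ω.flip z ∘ₗ LinearMap.inr ℝ ℝ L).ker)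
    (fun x _ y _ => by
      simpa [LieAlgebra.Prod.bracket_apply] using
        hω.apply_lie_eq_zero_of_mem_center hz (0, x) (0, y)) hu

theorem apply_eq_zero_of_snd_mem (hω : IsSymplecticStructure ω) {x z : ℝ × L}
    (hx : x.2 ∈ ⁅(⊤ : LieIdeal ℝ L), (⊤ : LieIdeal ℝ L)⁆)
    (hz : z.2 ∈ ⁅(⊤ : LieIdeal ℝ L), (⊤ : LieIdeal ℝ L)⁆)
    (hzc : z.2 ∈ LieAlgebra.center ℝ L) : ω x z = 0 := by
  obtain ⟨⟨t, u⟩, s, w⟩ := x, z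
  have hu (s : ℝ) : ω (0, u) (s, w) = 0 :=
    hω.apply_zero_mk_eq_zero_of_mem_center hx (mem_center_prod_of_snd_mem hzc)
  have hw : ω (t, 0) (0, w) = 0 := by
    rw [← LinearMap.IsAlt.neg hω.alternating, hω.apply_zero_mk_eq_zero_of_mem_center (u := w) hz
      (mem_center_prod_of_snd_mem (z := (t, 0)) (zero_mem _)), neg_zero]
  have hreal : ω (t, 0) (s, 0) = 0 := by
    rw [show ((t, 0) : ℝ × L) = t • (1, 0) by simp, show ((s, 0) : ℝ × L) = s • (1, 0) by simp,
      map_smul, map_smul, LinearMap.smul_apply, hω.alternating, smul_zero, smul_zero]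
  have hsplit (t : ℝ) (u : L) : (t, u) = (t, 0) + (0, u) := by simp
  rw [hsplit t u, map_add, LinearMap.add_apply, hu, add_zero, hsplit s w, map_add, hreal, hw,
    add_zero]

end IsSymplecticStructure

namespace IsSymplecticLieAlgebra

variable {L ι κ : Type*} [LieRing L] [LieAlgebra ℝ L] [Fintype ι] [Fintype κ]

theorem even_finrank (h : IsSymplecticLieAlgebra L) : Even (Module.finrank ℝ L) :=
  let ⟨_, hω⟩ := h
  even_finrank_of_isAlt hω.nondegenerate hω.alternating

theorem card_le_card (h : IsSymplecticLieAlgebra L) {g : κ → L}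
    (hg : LieSubalgebra.lieSpan ℝ L (Set.range g) = ⊤) {w : ι → L} (hw : LinearIndependent ℝ w)
    (hwc : ∀ i, w i ∈ LieAlgebra.center ℝ L) : Fintype.card ι ≤ Fintype.card κ :=
  let ⟨_, hω⟩ := h
  card_le_card_of_sup_span_eq_top hω.nondegenerate hw
    (fun _ hx i => hω.apply_eq_zero_of_mem_center hx (hwc i)) (derivedIdeal_sup_span_eq_top hg)

theorem card_lt_card_of_prod (h : IsSymplecticLieAlgebra (ℝ × L)) {g : κ → L}
    (hg : LieSubalgebra.lieSpan ℝ L (Set.range g) = ⊤) {w : ι → L} (hw : LinearIndependent ℝ w)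
    (hwc : ∀ i, w i ∈ LieAlgebra.center ℝ L)
    (hwd : ∀ i, w i ∈ ⁅(⊤ : LieIdeal ℝ L), (⊤ : LieIdeal ℝ L)⁆) :
    Fintype.card ι < Fintype.card κ := by
  obtain ⟨ω, hω⟩ := h
  let W : Submodule ℝ (ℝ × L) :=
    Submodule.prod ⊤ ⁅(⊤ : LieIdeal ℝ L), (⊤ : LieIdeal ℝ L)⁆.toSubmodule
  let w' : Unit ⊕ ι → ℝ × L := Sum.elim (fun _ => (1, 0)) fun i => (0, w i)
  have hw' : LinearIndependent ℝ w' :=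
    linearIndependent_inl_union_inr' (LinearIndependent.of_subsingleton () one_ne_zero) hw
  have hW : ∀ x ∈ W, ∀ i, ω x (w' i) = 0 := by
    rintro x ⟨-, hx⟩ (_ | i)
    · exact hω.apply_eq_zero_of_snd_mem hx (zero_mem _) (zero_mem _)
    · exact hω.apply_eq_zero_of_snd_mem hx (hwd i) (hwc i)
  have hWg : W ⊔ Submodule.span ℝ (Set.range fun c => (0, g c)) = ⊤ := by
    refine submodule_prod_eq_top (Submodule.mem_sup_left ⟨trivial, zero_mem _⟩)
      (eq_top_iff.mpr (derivedIdeal_sup_span_eq_top hg ▸ sup_le (fun d hd => ?_) ?_))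
    · exact Submodule.mem_sup_left ⟨trivial, hd⟩
    · refine Submodule.span_le.mpr (Set.range_subset_iff.mpr fun c => ?_)
      exact Submodule.mem_sup_right (Submodule.subset_span (Set.mem_range_self c))
  have hcard := card_le_card_of_sup_span_eq_top hω.nondegenerate hw' hW hWg
  rw [Fintype.card_sum, Fintype.card_unit] at hcard
  omega

end IsSymplecticLieAlgebra

namespace FreeNilpotentLieAlgebra

variable {m k n : ℕ}

/-- The projection from the free Lie algebra, as a morphism of Lie algebras. -/
noncomputable def proj (m k : ℕ) : FreeLieAlgebra ℝ (Fin m) →ₗ⁅ℝ⁆ FreeNilpotentLieAlgebra m k :=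
  { LieSubmodule.Quotient.mk' _ with
    map_lie' := LieSubmodule.Quotient.mk_bracket _ _ _ }

theorem proj_surjective (m k : ℕ) : Function.Surjective (proj m k) :=
  LieSubmodule.Quotient.surjective_mk' _

theorem proj_eq_zero_iff {x : FreeLieAlgebra ℝ (Fin m)} :
    proj m k x = 0 ↔ x ∈ LieModule.lowerCentralSeries ℝ (FreeLieAlgebra ℝ (Fin m))
      (FreeLieAlgebra ℝ (Fin m)) k :=
  LieSubmodule.Quotient.mk_eq_zero _

theorem proj_mem_center {x : FreeLieAlgebra ℝ (Fin m)}
    (hx : x ∈ LieModule.lowerCentralSeries ℝ (FreeLieAlgebra ℝ (Fin m))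
      (FreeLieAlgebra ℝ (Fin m)) k) :
    proj m (k + 1) x ∈ LieAlgebra.center ℝ (FreeNilpotentLieAlgebra m (k + 1)) := by
  refine (LieModule.mem_maxTrivSubmodule ..).mpr fun u => ?_
  obtain ⟨u, rfl⟩ := proj_surjective m (k + 1) u
  rw [← LieHom.map_lie]
  exact proj_eq_zero_iff.mpr (lie_mem_lowerCentralSeries_succ u hx)

/-- The canonical generators. -/
noncomputable def of (i : Fin m) : FreeNilpotentLieAlgebra m k :=
  proj m k (FreeLieAlgebra.of ℝ i)

theorem lieSpan_range_of :
    LieSubalgebra.lieSpan ℝ (FreeNilpotentLieAlgebra m k) (Set.range of) = ⊤ := by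
  rw [show (of : Fin m → FreeNilpotentLieAlgebra m k) = proj m k ∘ FreeLieAlgebra.of ℝ from rfl,
    Set.range_comp, ← LieSubalgebra.map_lieSpan, lieSpan_range_freeLieAlgebra_of]
  exact eq_top_iff.mpr fun x _ => (proj_surjective m k x).imp fun y hy => ⟨trivial, hy⟩

theorem proj_iteratedLie (l : List (Fin m)) (i j : Fin m) :
    proj m k (iteratedLie (FreeLieAlgebra.of ℝ) l i j) = iteratedLie of l i j :=
  map_iteratedLie ..

theorem iteratedLie_of_eq_zero {l : List (Fin m)} (hl : k ≤ l.length + 1) (i j : Fin m) :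
    iteratedLie of l i j = (0 : FreeNilpotentLieAlgebra m k) := by
  rw [← proj_iteratedLie, proj_eq_zero_iff]
  exact LieModule.antitone_lowerCentralSeries ℝ _ _ hl
    (iteratedLie_mem_lowerCentralSeries ℝ _ l i j)

theorem submodule_eq_top {K : Submodule ℝ (FreeNilpotentLieAlgebra m k)} (hof : ∀ i, of i ∈ K)
    (hlie : ∀ l i j, l.length + 2 ≤ k → i < j → iteratedLie of l i j ∈ K) : K = ⊤ := by
  refine eq_top_iff.mpr ?_
  rw [← span_range_union_iteratedLie_eq_top lieSpan_range_of, Submodule.span_le]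
  refine Set.union_subset (Set.range_subset_iff.mpr hof) ?_
  rintro _ ⟨l, i, j, rfl⟩
  obtain hl | hl : k ≤ l.length + 1 ∨ l.length + 2 ≤ k := by omega
  · exact iteratedLie_of_eq_zero hl i j ▸ zero_mem _
  obtain hij | rfl | hij := lt_trichotomy i j
  · exact hlie l i j hl hij
  · exact iteratedLie_self (of (k := k)) l i ▸ zero_mem _
  · exact iteratedLie_swap (of (k := k)) l i j ▸ neg_mem (hlie l j i hl hij)

/-- The functional induced by `foxCoeff μ j` on the free nilpotent Lie algebra. -/
noncomputable def coeff (μ : Multiset (Fin m)) (j : Fin m) (hμ : μ.card < k) :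
    FreeNilpotentLieAlgebra m k →ₗ[ℝ] ℝ :=
  Submodule.liftQ _ (foxCoeff μ j) fun _ => foxCoeff_eq_zero_of_mem_lowerCentralSeries hμ j

theorem coeff_proj {μ : Multiset (Fin m)} (j : Fin m) (hμ : μ.card < k)
    (x : FreeLieAlgebra ℝ (Fin m)) : coeff μ j hμ (proj m k x) = foxCoeff μ j x :=
  rfl

theorem coeff_of (μ : Multiset (Fin m)) (i j : Fin m) (hμ : μ.card < k) :
    coeff μ j hμ (of i) = if i = j ∧ 0 = μ then 1 else 0 :=
  foxCoeff_of μ i j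

theorem coeff_iteratedLie (μ : Multiset (Fin m)) (l : List (Fin m)) (i j d : Fin m)
    (hμ : μ.card < k) :
    coeff μ d hμ (iteratedLie of l i j) =
      (if j = d ∧ i ::ₘ (l : Multiset (Fin m)) = μ then 1 else 0) -
        if i = d ∧ j ::ₘ (l : Multiset (Fin m)) = μ then 1 else 0 := by
  rw [← proj_iteratedLie, coeff_proj, foxCoeff_iteratedLie]

theorem coeff_zero_lie (j : Fin m) (hk : Multiset.card (0 : Multiset (Fin m)) < k)
    (x y : FreeNilpotentLieAlgebra m k) : coeff 0 j hk ⁅x, y⁆ = 0 := by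
  obtain ⟨⟨x, rfl⟩, y, rfl⟩ := proj_surjective m k x, proj_surjective m k y
  rw [← LieHom.map_lie, coeff_proj]
  exact foxCoeff_eq_zero_of_mem_lowerCentralSeries zero_lt_one j
    (lie_mem_lowerCentralSeries_succ x (LieSubmodule.mem_top y))

theorem proj_eval (c : BasicCommutator (Fin m) n) :
    proj m k (c.eval (FreeLieAlgebra.of ℝ)) = c.eval of :=
  proj_iteratedLie ..

theorem linearIndependent_eval_of :
    LinearIndependent ℝ fun c : BasicCommutator (Fin m) n =>
      (c.eval of : FreeNilpotentLieAlgebra m (n + 2)) := by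
  have hcoeff (c d : BasicCommutator (Fin m) n) :
      coeff (k := n + 2) (c.1.1 ::ₘ c.1.2.2) c.1.2.1 (by simp) (d.eval of) =
        if c = d then 1 else 0 := by
    rw [← proj_eval, coeff_proj, BasicCommutator.foxCoeff_eval]
  exact .of_pairwise_dual_eq_zero_one _ _ (fun c d hcd => (hcoeff c d).trans (if_neg hcd))
    fun c => (hcoeff c c).trans (if_pos rfl)

theorem eval_of_mem_center (c : BasicCommutator (Fin m) n) :
    c.eval of ∈ LieAlgebra.center ℝ (FreeNilpotentLieAlgebra m (n + 2)) :=
  proj_eval c ▸ proj_mem_center (c.eval_mem_lowerCentralSeries ℝ _)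

theorem eval_of_mem_derivedIdeal (c : BasicCommutator (Fin m) n) :
    c.eval of ∈ ⁅(⊤ : LieIdeal ℝ (FreeNilpotentLieAlgebra m k)),
      (⊤ : LieIdeal ℝ (FreeNilpotentLieAlgebra m k))⁆ :=
  LieModule.antitone_lowerCentralSeries ℝ _ _ (Nat.succ_le_succ n.zero_le)
    (c.eval_mem_lowerCentralSeries ℝ of)

theorem card_basicCommutator_le
    (h : IsSymplecticLieAlgebra (FreeNilpotentLieAlgebra m (n + 2))) :
    Fintype.card (BasicCommutator (Fin m) n) ≤ m := by
  simpa using h.card_le_card lieSpan_range_of linearIndependent_eval_of eval_of_mem_center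

theorem card_basicCommutator_lt
    (h : IsSymplecticLieAlgebra (ℝ × FreeNilpotentLieAlgebra m (n + 2))) :
    Fintype.card (BasicCommutator (Fin m) n) < m := by
  simpa using h.card_lt_card_of_prod lieSpan_range_of linearIndependent_eval_of
    eval_of_mem_center eval_of_mem_derivedIdeal

end FreeNilpotentLieAlgebra

section CoboundaryForm

variable {R L : Type*} [CommRing R] [LieRing L] [LieAlgebra R L]

/-- The alternating form `(x, y) ↦ f ⁅x, y⁆`, which is up to sign the Chevalley–Eilenberg
differential of the functional `f`. -/
def coboundaryForm (f : Module.Dual R L) : LinearMap.BilinForm R L :=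
  (LieAlgebra.ad R L).toLinearMap.compr₂ f

theorem coboundaryForm_apply (f : Module.Dual R L) (x y : L) :
    coboundaryForm f x y = f ⁅x, y⁆ :=
  rfl

theorem coboundaryForm_isAlt (f : Module.Dual R L) : (coboundaryForm f).IsAlt := fun x => by
  rw [coboundaryForm_apply, lie_self, map_zero]

theorem coboundaryForm_closed (f : Module.Dual R L) (x y z : L) :
    coboundaryForm f ⁅x, y⁆ z + coboundaryForm f ⁅y, z⁆ x + coboundaryForm f ⁅z, x⁆ y = 0 := by
  have hJacobi : ⁅⁅x, y⁆, z⁆ + ⁅⁅y, z⁆, x⁆ + ⁅⁅z, x⁆, y⁆ = 0 := by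
    rw [← lie_skew ⁅x, y⁆ z, ← lie_skew ⁅y, z⁆ x, ← lie_skew ⁅z, x⁆ y, ← neg_add, ← neg_add,
      neg_eq_zero, ← lie_jacobi x y z]
    abel
  simp only [coboundaryForm_apply, ← map_add, hJacobi, map_zero]

/-- The form induced by `coboundaryForm f` on the quotient by an ideal in its radical. -/
noncomputable def quotientCoboundaryForm (I : LieIdeal R L) (f : Module.Dual R L)
    (hf : I.toSubmodule ≤ (coboundaryForm f).ker) : LinearMap.BilinForm R (L ⧸ I) :=
  LinearMap.IsRefl.liftQ₂ (coboundaryForm f) I.toSubmodule (coboundaryForm_isAlt f).isRefl hf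

variable {I : LieIdeal R L} {f : Module.Dual R L} (hf : I.toSubmodule ≤ (coboundaryForm f).ker)

theorem quotientCoboundaryForm_mk (x y : L) :
    quotientCoboundaryForm I f hf (LieSubmodule.Quotient.mk x) (LieSubmodule.Quotient.mk y) =
      f ⁅x, y⁆ :=
  rfl

theorem quotientCoboundaryForm_isAlt : (quotientCoboundaryForm I f hf).IsAlt := by
  rintro ⟨x⟩
  exact coboundaryForm_isAlt f x

theorem quotientCoboundaryForm_closed (x y z : L ⧸ I) :
    quotientCoboundaryForm I f hf ⁅x, y⁆ z + quotientCoboundaryForm I f hf ⁅y, z⁆ x +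
      quotientCoboundaryForm I f hf ⁅z, x⁆ y = 0 := by
  obtain ⟨⟨x⟩, ⟨y⟩, ⟨z⟩⟩ := x, y, z
  exact coboundaryForm_closed f x y z

end CoboundaryForm

section ProductForm

variable {L : Type*} [LieRing L] [LieAlgebra ℝ L]

/-- The form `ω + dt ∧ c` on `ℝ × L`, where `t` is the coordinate on `ℝ`. -/
noncomputable def productForm (ω : LinearMap.BilinForm ℝ L) (c : Module.Dual ℝ L) :
    LinearMap.BilinForm ℝ (ℝ × L) :=
  ω.compl₁₂ (LinearMap.snd ℝ ℝ L) (LinearMap.snd ℝ ℝ L) +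
    (LinearMap.mul ℝ ℝ).compl₁₂ (LinearMap.fst ℝ ℝ L) (c ∘ₗ LinearMap.snd ℝ ℝ L) -
      (LinearMap.mul ℝ ℝ).compl₁₂ (c ∘ₗ LinearMap.snd ℝ ℝ L) (LinearMap.fst ℝ ℝ L)

variable {ω : LinearMap.BilinForm ℝ L} {c : Module.Dual ℝ L}

theorem productForm_apply (x y : ℝ × L) :
    productForm ω c x y = ω x.2 y.2 + x.1 * c y.2 - c x.2 * y.1 :=
  rfl

theorem productForm_isAlt (hω : ω.IsAlt) : (productForm ω c).IsAlt := fun x => by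
  rw [productForm_apply, hω, zero_add, mul_comm, sub_self]

theorem productForm_closed (hω : ∀ x y z : L, ω ⁅x, y⁆ z + ω ⁅y, z⁆ x + ω ⁅z, x⁆ y = 0)
    (hc : ∀ x y : L, c ⁅x, y⁆ = 0) (x y z : ℝ × L) :
    productForm ω c ⁅x, y⁆ z + productForm ω c ⁅y, z⁆ x + productForm ω c ⁅z, x⁆ y = 0 := by
  simpa [productForm_apply, LieAlgebra.Prod.bracket_apply, LieRing.of_associative_ring_bracket,
    mul_comm, hc] using hω x.2 y.2 z.2

end ProductForm

namespace FreeNilpotentLieAlgebra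

theorem span_two_two :
    Submodule.span ℝ
      (Set.range ![(of 0 : FreeNilpotentLieAlgebra 2 2), of 1, iteratedLie of [] 0 1]) = ⊤ := by
  refine submodule_eq_top (Fin.forall_fin_two.mpr ⟨?_, ?_⟩) fun l i j hl hij => ?_
  · exact Submodule.subset_span ⟨0, rfl⟩
  · exact Submodule.subset_span ⟨1, rfl⟩
  · obtain rfl : l = [] := List.eq_nil_of_length_eq_zero (by omega)
    obtain ⟨rfl, rfl⟩ : i = 0 ∧ j = 1 := by omega
    exact Submodule.subset_span ⟨2, rfl⟩

theorem span_two_three :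
    Submodule.span ℝ
      (Set.range ![(of 0 : FreeNilpotentLieAlgebra 2 3), of 1, iteratedLie of [] 0 1,
        iteratedLie of [0] 0 1, iteratedLie of [1] 0 1]) = ⊤ := by
  refine submodule_eq_top (Fin.forall_fin_two.mpr ⟨?_, ?_⟩) fun l i j hl hij => ?_
  · exact Submodule.subset_span ⟨0, rfl⟩
  · exact Submodule.subset_span ⟨1, rfl⟩
  · obtain ⟨rfl, rfl⟩ : i = 0 ∧ j = 1 := by omega
    obtain _ | ⟨a, _ | _⟩ := l
    · exact Submodule.subset_span ⟨2, rfl⟩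
    · obtain rfl | rfl : a = 0 ∨ a = 1 := by omega
      · exact Submodule.subset_span ⟨3, rfl⟩
      · exact Submodule.subset_span ⟨4, rfl⟩
    · simp at hl

theorem span_three_two :
    Submodule.span ℝ
      (Set.range ![(of 0 : FreeNilpotentLieAlgebra 3 2), of 1, of 2, iteratedLie of [] 1 2,
        iteratedLie of [] 0 2, iteratedLie of [] 0 1]) = ⊤ := by
  refine submodule_eq_top (Fin.forall_fin_succ.mpr ⟨?_, Fin.forall_fin_two.mpr ⟨?_, ?_⟩⟩)
    fun l i j hl hij => ?_
  · exact Submodule.subset_span ⟨0, rfl⟩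
  · exact Submodule.subset_span ⟨1, rfl⟩
  · exact Submodule.subset_span ⟨2, rfl⟩
  · obtain rfl : l = [] := List.eq_nil_of_length_eq_zero (by omega)
    obtain ⟨rfl, rfl⟩ | ⟨rfl, rfl⟩ | ⟨rfl, rfl⟩ :
      i = 1 ∧ j = 2 ∨ i = 0 ∧ j = 2 ∨ i = 0 ∧ j = 1 := by omega
    · exact Submodule.subset_span ⟨3, rfl⟩
    · exact Submodule.subset_span ⟨4, rfl⟩
    · exact Submodule.subset_span ⟨5, rfl⟩

theorem finrank_two_two : Module.finrank ℝ (FreeNilpotentLieAlgebra 2 2) = 3 := by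
  let μ : Fin 3 → Multiset (Fin 2) := ![0, 0, {0}]
  let d : Fin 3 → Fin 2 := ![0, 1, 1]
  have hμ : ∀ a, (μ a).card < 2 := by decide
  refine finrank_eq_card_of_dual span_two_two (f := fun a => coeff (μ a) (d a) (hμ a)) ?_
  intro a b
  fin_cases a <;> fin_cases b <;> simp +decide [μ, d, coeff_of, coeff_iteratedLie]

theorem finrank_two_three : Module.finrank ℝ (FreeNilpotentLieAlgebra 2 3) = 5 := by
  let μ : Fin 5 → Multiset (Fin 2) := ![0, 0, {0}, {0, 0}, {0, 1}]
  let d : Fin 5 → Fin 2 := ![0, 1, 1, 1, 1]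
  have hμ : ∀ a, (μ a).card < 3 := by decide
  refine finrank_eq_card_of_dual span_two_three (f := fun a => coeff (μ a) (d a) (hμ a)) ?_
  intro a b
  fin_cases a <;> fin_cases b <;> simp +decide [μ, d, coeff_of, coeff_iteratedLie]

variable {m k : ℕ}

/-- The closed `2`-form on the free `k`-step nilpotent Lie algebra that sends a pair of elements to
the value of `f` on the bracket of their lifts to the free `(k + 1)`-step nilpotent Lie algebra. -/
noncomputable def bracketForm (f : Module.Dual ℝ (FreeNilpotentLieAlgebra m (k + 1))) :
    LinearMap.BilinForm ℝ (FreeNilpotentLieAlgebra m k) :=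
  quotientCoboundaryForm _ (f ∘ₗ (proj m (k + 1)).toLinearMap) fun y hy => LinearMap.ext fun x => by
    have hxy := (LieModule.mem_maxTrivSubmodule ..).mp (proj_mem_center hy) (proj m (k + 1) x)
    rw [coboundaryForm_apply, LinearMap.comp_apply, LieHom.coe_toLinearMap, LieHom.map_lie,
      ← lie_skew, hxy, neg_zero, map_zero, LinearMap.zero_apply]

variable (f : Module.Dual ℝ (FreeNilpotentLieAlgebra m (k + 1)))

theorem bracketForm_proj (x y : FreeLieAlgebra ℝ (Fin m)) :
    bracketForm f (proj m k x) (proj m k y) = f ⁅proj m (k + 1) x, proj m (k + 1) y⁆ := by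
  rw [← LieHom.map_lie]
  exact quotientCoboundaryForm_mk _ x y

theorem bracketForm_isAlt : (bracketForm f).IsAlt :=
  quotientCoboundaryForm_isAlt _

theorem bracketForm_of_of (i j : Fin m) :
    bracketForm f (of i) (of j) = f (iteratedLie of [] i j) :=
  bracketForm_proj f _ _

theorem bracketForm_of_iteratedLie (a : Fin m) (l : List (Fin m)) (i j : Fin m) :
    bracketForm f (of a) (iteratedLie of l i j) = f (iteratedLie of (a :: l) i j) := by
  rw [← proj_iteratedLie, of, bracketForm_proj, proj_iteratedLie]
  rfl

theorem bracketForm_iteratedLie_of (l : List (Fin m)) (i j a : Fin m) :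
    bracketForm f (iteratedLie of l i j) (of a) = -f (iteratedLie of (a :: l) i j) := by
  rw [← bracketForm_of_iteratedLie, LinearMap.IsAlt.neg (bracketForm_isAlt f)]

theorem bracketForm_iteratedLie_iteratedLie
    (f : Module.Dual ℝ (FreeNilpotentLieAlgebra m 3)) (i j a b : Fin m) :
    bracketForm f (iteratedLie of [] i j) (iteratedLie of [] a b) = 0 := by
  rw [← proj_iteratedLie, ← proj_iteratedLie, bracketForm_proj, proj_iteratedLie,
    proj_iteratedLie, iteratedLie_nil of i, lie_lie, ← iteratedLie_cons, ← iteratedLie_cons,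
    ← iteratedLie_cons, ← iteratedLie_cons, iteratedLie_of_eq_zero (by simp),
    iteratedLie_of_eq_zero (by simp), sub_zero, map_zero]

theorem isSymplecticLieAlgebra_three_two :
    IsSymplecticLieAlgebra (FreeNilpotentLieAlgebra 3 2) := by
  let f : Module.Dual ℝ (FreeNilpotentLieAlgebra 3 3) :=
    coeff {0, 1} 2 (by decide) - coeff {0, 2} 1 (by decide)
  let w : Fin 6 → FreeNilpotentLieAlgebra 3 2 :=
    ![iteratedLie of [] 1 2, iteratedLie of [] 0 2, iteratedLie of [] 0 1, of 0, of 1, of 2]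
  refine ⟨bracketForm f, bracketForm_isAlt f, quotientCoboundaryForm_closed _,
    (bracketForm_isAlt f).isRefl.nondegenerate_iff_separatingLeft.mpr
      (separatingLeft_of_apply_ne_zero_iff span_three_two (w := w) fun a b => ?_)⟩
  fin_cases a <;> fin_cases b <;>
    simp +decide [w, bracketForm_of_of, bracketForm_of_iteratedLie, bracketForm_iteratedLie_of,
      bracketForm_iteratedLie_iteratedLie, f, coeff_iteratedLie]

theorem isSymplecticLieAlgebra_real_prod_two_two :
    IsSymplecticLieAlgebra (ℝ × FreeNilpotentLieAlgebra 2 2) := by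
  let ω := bracketForm (coeff (m := 2) (k := 3) {0, 0} 1 (by decide))
  let c := coeff (m := 2) (k := 2) 0 1 (by decide)
  let v : Fin 4 → ℝ × FreeNilpotentLieAlgebra 2 2 :=
    ![(1, 0), (0, of 0), (0, of 1), (0, iteratedLie of [] 0 1)]
  let w : Fin 4 → ℝ × FreeNilpotentLieAlgebra 2 2 :=
    ![(0, of 1), (0, iteratedLie of [] 0 1), (1, 0), (0, of 0)]
  have hspan : Submodule.span ℝ (Set.range v) = ⊤ := by
    refine submodule_prod_eq_top (Submodule.subset_span ⟨0, rfl⟩) (eq_top_iff.mpr ?_)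
    rw [← span_two_two, Submodule.span_le]
    rintro _ ⟨a, rfl⟩
    refine Submodule.subset_span ⟨a.succ, ?_⟩
    fin_cases a <;> rfl
  have halt : (productForm ω c).IsAlt := productForm_isAlt (bracketForm_isAlt _)
  refine ⟨productForm ω c, halt,
    productForm_closed (quotientCoboundaryForm_closed _) (coeff_zero_lie 1 _),
    halt.isRefl.nondegenerate_iff_separatingLeft.mpr
      (separatingLeft_of_apply_ne_zero_iff hspan (w := w) fun a b => ?_)⟩
  fin_cases a <;> fin_cases b <;>
    simp +decide [v, w, ω, c, productForm_apply, bracketForm_of_of, bracketForm_of_iteratedLie,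
      bracketForm_iteratedLie_of, bracketForm_iteratedLie_iteratedLie, coeff_of, coeff_iteratedLie]

end FreeNilpotentLieAlgebra

theorem mainTheorem1_general (m k : ℕ) (hm : 2 ≤ m) (hk : 2 ≤ k) :
    (IsSymplecticLieAlgebra (FreeNilpotentLieAlgebra m k) ↔ (m, k) = (3, 2)) ∧
    (IsSymplecticLieAlgebra (ℝ × FreeNilpotentLieAlgebra m k) ↔ (m, k) = (2, 2)) := by
  obtain ⟨n, rfl⟩ := Nat.exists_eq_add_of_le' hk
  refine ⟨⟨fun h => ?_, fun h => ?_⟩, ⟨fun h => ?_, fun h => ?_⟩⟩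
  · have hcard := FreeNilpotentLieAlgebra.card_basicCommutator_le h
    have h22 : (m, n) ≠ (2, 0) := by
      rintro ⟨⟩
      exact absurd h.even_finrank (FreeNilpotentLieAlgebra.finrank_two_two ▸ by decide)
    have h23 : (m, n) ≠ (2, 1) := by
      rintro ⟨⟩
      exact absurd h.even_finrank (FreeNilpotentLieAlgebra.finrank_two_three ▸ by decide)
    contrapose! hcard with h32
    exact BasicCommutator.lt_card hm (by grind) (by grind)
  · obtain ⟨rfl, rfl⟩ : m = 3 ∧ n = 0 := by simpa using h
    exact FreeNilpotentLieAlgebra.isSymplecticLieAlgebra_three_two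
  · have hcard := FreeNilpotentLieAlgebra.card_basicCommutator_lt h
    contrapose! hcard with h22
    exact BasicCommutator.le_card hm (by grind)
  · obtain ⟨rfl, rfl⟩ : m = 2 ∧ n = 0 := by simpa using h
    exact FreeNilpotentLieAlgebra.isSymplecticLieAlgebra_real_prod_two_two

theorem mainTheorem1 (m k : ℕ) (hm : 2 ≤ m) (hk : 2 ≤ k) :
    (Even (Module.finrank ℝ (FreeNilpotentLieAlgebra m k)) →
      (IsSymplecticLieAlgebra (FreeNilpotentLieAlgebra m k) ↔ (m, k) = (3, 2))) ∧
    (Odd (Module.finrank ℝ (FreeNilpotentLieAlgebra m k)) →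
      (IsSymplecticLieAlgebra (ℝ × FreeNilpotentLieAlgebra m k) ↔ (m, k) = (2, 2))) :=
  let ⟨hn, hprod⟩ := mainTheorem1_general m k hm hk
  ⟨fun _ => hn, fun _ => hprod⟩
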